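/- All digraphs are finite, without loops and without digons (directed 2-cycles). For a vertex $v$ of a digraph $D$, let $N^+(v)$ be its set of out-neighbors and $N^{++}(v)$ the set of vertices at directed distance exactly $2$ from $v$; $v$ has the second neighborhood property (SNP) if $|N^+(v)|\le |N^{++}(v)|$, and $v$ is a sink if $N^+(v)=\emptyset$. A missing edge of $D$ is an unordered pair $xy$ of distinct vertices with neither $(x,y)$ nor $(y,x)$ an arc of $D$. A missing edge $e$ loses to a missing edge $f$ if one can write $e=x_1y_1$ and $f=x_2y_2$ so that $x_1\to x_2$, $y_2\notin N^+(x_1)\cup N^{++}(x_1)$, $y_1\to y_2$ and $x_2\notin N^+(y_1)\cup N^{++}(y_1)$. The dependency digraph $\Delta$ of $D$ (in which, exceptionally, digons are allowed) has the missing edges of $D$ as vertices and an arc from $e$ to $f$ whenever $e$ loses to $f$. Theorem 7. Let $D$ be a digraph obtained from a tournament by deleting the edges of two vertex-disjoint stars (each consisting of edges joining a center to the other vertices of the star). Suppose that the dependency digraph $\Delta$ of $D$ has at least one vertex, that its minimum out-degree $\delta^+_\Delta$ and its minimum in-degree $\delta^-_\Delta$ are both positive, and that $D$ has no sink. Then $D$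 has at least two distinct vertices with the SNP. -/

import Mathlib

namespace Digraph

variable {V : Type*}

/-- A tournament: no loops, and exactly one arc between any two distinct vertices. -/
def IsTournament (T : Digraph V) : Prop :=
  (∀ v, ¬ T.Adj v v) ∧ ∀ u v, u ≠ v → Xor (T.Adj u v) (T.Adj v u)

/-- The edge set of the star with center `c` and set of leaves `A`. -/
def starEdges (c : V) (A : Set V) : Set (Sym2 V) :=
  (fun a => s(c, a)) '' A

/-- Delete from `T` every arc whose underlying unordered pair lies in `E`. -/
def deleteEdges (T : Digraph V) (E : Set (Sym2 V)) : Digraph V where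
  Adj u v := T.Adj u v ∧ s(u, v) ∉ E

/-- The first out-neighborhood of `v`. -/
def outNbhd (D : Digraph V) (v : V) : Set V := {w | D.Adj v w}

/-- The first in-neighborhood of `v`. -/
def inNbhd (D : Digraph V) (v : V) : Set V := {w | D.Adj w v}

/-- The second out-neighborhood of `v`: the vertices at distance exactly two from `v`. -/
def outNbhd₂ (D : Digraph V) (v : V) : Set V :=
  {w | w ≠ v ∧ ¬ D.Adj v w ∧ ∃ u, D.Adj v u ∧ D.Adj u w}

/-- The out-degree of `v`. -/
noncomputable def outDeg (D : Digraph V) (v : V) : ℕ := (D.outNbhd v).ncard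

/-- The in-degree of `v`. -/
noncomputable def inDeg (D : Digraph V) (v : V) : ℕ := (D.inNbhd v).ncard

/-- The size of the second out-neighborhood of `v`. -/
noncomputable def outDeg₂ (D : Digraph V) (v : V) : ℕ := (D.outNbhd₂ v).ncard

/-- The minimum out-degree (`0` for the digraph without vertices). -/
noncomputable def minOutDeg (D : Digraph V) : ℕ := ⨅ v, D.outDeg v

/-- The minimum in-degree (`0` for the digraph without vertices). -/
noncomputable def minInDeg (D : Digraph V) : ℕ := ⨅ v, D.inDeg v

/-- A sink is a vertex of out-degree zero. -/
def IsSink (D : Digraph V) (v : V) : Prop := D.outDeg v = 0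

/-- The second neighborhood property of a vertex. -/
def HasSNP (D : Digraph V) (v : V) : Prop := D.outDeg v ≤ D.outDeg₂ v

/-- The missing edges of `D`: unordered pairs of distinct non-adjacent vertices. -/
def missingEdges (D : Digraph V) : Set (Sym2 V) :=
  {e | ∃ x y, e = s(x, y) ∧ x ≠ y ∧ ¬ D.Adj x y ∧ ¬ D.Adj y x}

/-- The pair `e` loses to the pair `f`: for a suitable labelling `e = x₁y₁`, `f = x₂y₂` one has
`x₁ → x₂`, `y₂ ∉ N⁺(x₁) ∪ N⁺⁺(x₁)`, `y₁ → y₂` and `x₂ ∉ N⁺(y₁) ∪ N⁺⁺(y₁)`. -/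
def LosesTo (D : Digraph V) (e f : Sym2 V) : Prop :=
  ∃ x₁ y₁ x₂ y₂, e = s(x₁, y₁) ∧ f = s(x₂, y₂) ∧
    D.Adj x₁ x₂ ∧ y₂ ∉ D.outNbhd x₁ ∪ D.outNbhd₂ x₁ ∧
    D.Adj y₁ y₂ ∧ x₂ ∉ D.outNbhd y₁ ∪ D.outNbhd₂ y₁

/-- The dependency digraph `Δ` of `D`: its vertices are the missing edges of `D`, and there is an
arc from `e` to `f` when `e` loses to `f`. -/
def dependency (D : Digraph V) : Digraph D.missingEdges where
  Adj e f := D.LosesTo e f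

end Digraph

/-! Two vertices that are not the center and a leaf of one star are adjacent. So the centers are
adjacent, say `x → y`, and losing then forces vertices outside to be treated alike: positive minimum
degrees in the dependency digraph make `K`, the union of both stars, a module with `x → y`, `y → A`
and `B → x` (`MissingStars.starModule`).

Let `P` and `Q` be the first and second out-neighborhoods outside `K`, common to all vertices of
`K`. If `|P| ≤ |Q|`, the property need only be checked inside `K`: it holds for `x`, and for a leaf
having it in the tournament induced on `A ∪ B`. If `|P| > |Q|`, replacing `K` by a transitive
tournament gives a sinkless tournament. By the Havet–Thomassé theorem
(`exists_two_card_out_le_card_sec`, proved by median orders and sedimentation) two of its vertices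
have the property. They lie outside `K`, and they keep the property in `D`. -/

open Finset

/-! ### Median orders and the Havet–Thomassé theorem -/

namespace MedianOrder

open scoped Classical

variable {V : Type*} (r : V → V → Prop) (S : Finset V)

/-- The out-neighbors of `v` in `S`. -/
noncomputable def out (v : V) : Finset V := {w ∈ S | r v w}

/-- The second out-neighbors of `v` in the digraph induced on `S`. -/
noncomputable def sec (v : V) : Finset V :=
  {w ∈ S | w ≠ v ∧ ¬ r v w ∧ ∃ u ∈ S, r v u ∧ r u w}

/-- The arcs inside `S` that go forward with respect to the ranking `p`. -/
noncomputable def fwd (p : V → ℕ) : Finset (V × V) :=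
  {e ∈ S ×ˢ S | r e.1 e.2 ∧ p e.1 < p e.2}

/-- A ranking is a median order of `S` if it has the maximum number of forward arcs. -/
def IsMedian (p : V → ℕ) : Prop :=
  p.Injective ∧ ∀ q : V → ℕ, q.Injective → #(fwd r S q) ≤ #(fwd r S p)

/-- The in-neighbors `g` of `v` that are dominated by an out-neighbor of `v` preceding `g`. -/
noncomputable def good (p : V → ℕ) (v : V) : Finset V :=
  {g ∈ S | r g v ∧ ∃ w ∈ S, r v w ∧ p w < p g ∧ r w g}

variable {r S}

/-- Injective rankings by naturals are infinitely many, so a maximizer must come from a bound on the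
quantity being maximized. -/
lemma exists_maximal {α : Type*} (P : α → Prop) (f : α → ℕ) (N : ℕ) (h0 : ∃ a, P a)
    (hf : ∀ a, f a ≤ N) : ∃ a, P a ∧ ∀ b, P b → f b ≤ f a := by
  obtain ⟨a, ha, hmax⟩ := (measure fun a => N - f a).wf.has_min {a | P a} h0
  refine ⟨a, ha, fun b hb => ?_⟩
  have h1 := hmax b hb
  have h2 := hf a
  have h3 := hf b
  change ¬ (N - f b < N - f a) at h1
  omega

lemma exists_isMedian [Finite V] : ∃ p, IsMedian r S p := by
  obtain ⟨n, ⟨e⟩⟩ := Finite.exists_equiv_fin V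
  obtain ⟨p, hp, hmax⟩ := exists_maximal (fun p : V → ℕ => p.Injective)
    (fun p => #(fwd r S p)) #(S ×ˢ S)
    ⟨fun v => e v, Fin.val_injective.comp e.injective⟩ (fun p => card_filter_le _ _)
  exact ⟨p, hp, hmax⟩

lemma card_sdiff_le_of_card_le {α : Type*} [DecidableEq α] {s t : Finset α} (h : #s ≤ #t) :
    #(s \ t) ≤ #(t \ s) := by
  have h1 := card_sdiff_add_card_inter s t
  have h2 := card_sdiff_add_card_inter t s
  rw [inter_comm] at h2
  omega

lemma card_le_of_card_sdiff_le {α : Type*} [DecidableEq α] {s t : Finset α} (h : #(s \ t) ≤ #(t \ s)) :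
    #s ≤ #t := by
  have h1 := card_sdiff_add_card_inter s t
  have h2 := card_sdiff_add_card_inter t s
  rw [inter_comm] at h2
  omega

/-- The feedback property of median orders. -/
lemma IsMedian.feedback (hasymm : ∀ u v, r u v → ¬ r v u) {p : V → ℕ} (hp : IsMedian r S p)
    {v : V} (hv : v ∈ S) (t : ℕ) :
    #{w ∈ S | r v w ∧ t ≤ p w ∧ p w < p v} ≤ #{w ∈ S | r w v ∧ t ≤ p w ∧ p w < p v} := by
  rcases le_or_gt (p v) t with htv | htv
  · rw [filter_false_of_mem]
    · simp
    · intro w _ h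
      omega
  -- Doubling makes room to reinsert `v` just before the vertices of rank at least `t`; only arcs
  -- between `v` and ranks in `[t, p v)` change direction.
  set q : V → ℕ := fun w => if w = v then 2 * t else 2 * p w + 1 with hq
  have hqv : q v = 2 * t := by simp [hq]
  have hqw : ∀ w, w ≠ v → q w = 2 * p w + 1 := fun w hw => by simp [hq, hw]
  have hqinj : q.Injective := by
    intro a b hab
    by_cases ha : a = v <;> by_cases hb : b = v
    · rw [ha, hb]
    · rw [ha, hqv, hqw b hb] at hab
      omega
    · rw [hb, hqv, hqw a ha] at hab
      omega
    · rw [hqw a ha, hqw b hb] at hab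
      exact hp.1 (by omega)
  have key := card_sdiff_le_of_card_le (hp.2 q hqinj)
  have hirr : ∀ u, ¬ r u u := fun u h => hasymm u u h h
  calc _ ≤ #(fwd r S q \ fwd r S p) := by
        refine card_le_card_of_injOn (fun w => (v, w)) ?_ ?_
        · intro w hw
          simp only [coe_filter, Set.mem_ofPred_eq] at hw
          obtain ⟨hwS, hvw, h1, h2⟩ := hw
          have hne : w ≠ v := fun h => hirr v (h ▸ hvw)
          simp only [fwd, coe_sdiff, coe_filter, Set.mem_sdiff, Set.mem_ofPred_eq, mem_product,
            hqv, hqw w hne]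
          refine ⟨⟨⟨hv, hwS⟩, hvw, by omega⟩, fun h => by omega⟩
        · intro a _ b _ h
          exact (Prod.mk.inj h).2
    _ ≤ #(fwd r S p \ fwd r S q) := key
    _ ≤ _ := by
        refine card_le_card_of_injOn Prod.fst ?_ ?_
        · rintro ⟨a, b⟩ hab
          simp only [fwd, coe_sdiff, coe_filter, Set.mem_sdiff, Set.mem_ofPred_eq,
            mem_product] at hab
          obtain ⟨⟨⟨ha, hb⟩, hr, hlt⟩, hn⟩ := hab
          have hn' : ¬ q a < q b := fun h => hn ⟨⟨ha, hb⟩, hr, h⟩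
          have hbv : b = v := by
            by_contra hbv
            by_cases hav : a = v
            · subst hav
              rw [hqv, hqw b hbv] at hn'
              omega
            · rw [hqw a hav, hqw b hbv] at hn'
              omega
          subst hbv
          have hab : a ≠ b := fun h => hirr b (h ▸ hr)
          rw [hqv, hqw a hab] at hn'
          simp only [coe_filter, Set.mem_ofPred_eq]
          exact ⟨ha, hr, by omega, hlt⟩
        · rintro ⟨a, b⟩ hab ⟨a', b'⟩ hab' h
          simp only [fwd, coe_sdiff, coe_filter, Set.mem_sdiff, Set.mem_ofPred_eq,
            mem_product] at hab hab'
          have hsnd : ∀ a b, ((a ∈ S ∧ b ∈ S) ∧ r a b ∧ p a < p b) ∧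
              ¬ ((a ∈ S ∧ b ∈ S) ∧ r a b ∧ q a < q b) → b = v := by
            rintro a b ⟨⟨hS, hr, hlt⟩, hn⟩
            have hn' : ¬ q a < q b := fun h => hn ⟨hS, hr, h⟩
            by_contra hbv
            by_cases hav : a = v
            · subst hav
              rw [hqv, hqw b hbv] at hn'
              omega
            · rw [hqw a hav, hqw b hbv] at hn'
              omega
          rw [hsnd a b hab, hsnd a' b' hab']
          exact Prod.ext h rfl

/-- The Havet–Thomassé bound on every final segment of a median order. -/
lemma IsMedian.card_out_le_card_good (hasymm : ∀ u v, r u v → ¬ r v u)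
    (htot : ∀ u ∈ S, ∀ v ∈ S, u ≠ v → r u v ∨ r v u) {p : V → ℕ} (hp : IsMedian r S p)
    {v : V} (hv : v ∈ S) (hlast : ∀ w ∈ S, p w ≤ p v) (t : ℕ) :
    #{w ∈ out r S v | t ≤ p w} ≤ #{w ∈ good r S p v | t ≤ p w} := by
  have hirr : ∀ u, ¬ r u u := fun u h => hasymm u u h h
  have hlt : ∀ w ∈ S, w ≠ v → p w < p v := fun w hw hne =>
    lt_of_le_of_ne (hlast w hw) fun h => hne (hp.1 h)
  induction hn : p v + 1 - t using Nat.strong_induction_on generalizing t with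
  | _ n ih =>
  -- Cut at the earliest bad in-neighbor `b` of `v`. Being bad, `b` dominates every earlier
  -- out-neighbor of `v`. Hence the in-neighbors of `b` in `[t, p b)` all dominate `v`, and they are
  -- good because `b` is the earliest bad one. Feedback at `b` handles this interval, induction the
  -- ranks after `b`.
  by_cases hbad : ∃ b ∈ S, r b v ∧ b ∉ good r S p v ∧ t ≤ p b
  · obtain ⟨b, hb, hmin⟩ := exists_min_image
      {b ∈ S | r b v ∧ b ∉ good r S p v ∧ t ≤ p b} p (by
        obtain ⟨b, hb, h⟩ := hbad
        exact ⟨b, mem_filter.2 ⟨hb, h⟩⟩)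
    obtain ⟨hbS, hbv, hbg, htb⟩ := mem_filter.1 hb
    have hbne : b ≠ v := fun h => hirr v (h ▸ hbv)
    have hdom : ∀ w ∈ S, r v w → p w < p b → r b w := by
      intro w hw hvw hwb
      rcases htot b hbS w hw (fun h => by subst h; omega) with h | h
      · exact h
      · exact absurd (mem_filter.2 ⟨hbS, hbv, w, hw, hvw, hwb, h⟩) hbg
    have hih := ih (p v + 1 - (p b + 1)) (by have := hlt b hbS hbne; omega) (p b + 1) rfl
    have hfb := hp.feedback hasymm hbS t
    have h1 : #{w ∈ out r S v | t ≤ p w} ≤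
        #{w ∈ S | r b w ∧ t ≤ p w ∧ p w < p b} + #{w ∈ out r S v | p b + 1 ≤ p w} := by
      refine (card_le_card ?_).trans (card_union_le _ _)
      intro w hw
      simp only [out, mem_filter, mem_union] at hw ⊢
      obtain ⟨⟨hwS, hvw⟩, htw⟩ := hw
      rcases lt_trichotomy (p w) (p b) with h | h | h
      · exact Or.inl ⟨hwS, hdom w hwS hvw h, htw, h⟩
      · rw [hp.1 h] at hvw
        exact absurd hvw (hasymm _ _ hbv)
      · exact Or.inr ⟨⟨hwS, hvw⟩, h⟩
    have h2 : #{w ∈ S | r w b ∧ t ≤ p w ∧ p w < p b} + #{w ∈ good r S p v | p b + 1 ≤ p w} ≤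
        #{w ∈ good r S p v | t ≤ p w} := by
      rw [← card_union_of_disjoint]
      · refine card_le_card ?_
        intro w hw
        rcases mem_union.1 hw with h | h
        · obtain ⟨hwS, hwb, htw, hlt'⟩ := mem_filter.1 h
          refine mem_filter.2 ⟨?_, htw⟩
          have hwv : r w v := by
            rcases htot w hwS v hv (fun h => by
              have := hlast b hbS
              subst h; omega) with h | h
            · exact h
            · exact absurd (hdom w hwS h hlt') (hasymm _ _ hwb)
          by_contra hg
          have := hmin w (mem_filter.2 ⟨hwS, hwv, hg, htw⟩)
          omega
        · obtain ⟨hg, hw'⟩ := mem_filter.1 h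
          exact mem_filter.2 ⟨hg, by omega⟩
      · rw [disjoint_left]
        intro w h h'
        have := (mem_filter.1 h).2
        have := (mem_filter.1 h').2
        omega
    omega
  · push Not at hbad
    refine le_trans (card_le_card ?_) ((hp.feedback hasymm hv t).trans (card_le_card ?_))
    · intro w hw
      simp only [out, mem_filter] at hw ⊢
      exact ⟨hw.1.1, hw.1.2, hw.2, hlt w hw.1.1 fun h => hirr v (h ▸ hw.1.2)⟩
    · intro w hw
      obtain ⟨hwS, hwv, htw, -⟩ := mem_filter.1 hw
      refine mem_filter.2 ⟨?_, htw⟩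
      by_contra hg
      have := hbad w hwS hwv hg
      omega

lemma good_subset_sec (hasymm : ∀ u v, r u v → ¬ r v u) (p : V → ℕ) (v : V) :
    good r S p v ⊆ sec r S v := by
  intro g hg
  obtain ⟨hgS, hgv, w, hw, hvw, -, hwg⟩ := mem_filter.1 hg
  exact mem_filter.2 ⟨hgS, fun h => hasymm g v hgv (h ▸ hgv), hasymm _ _ hgv, w, hw, hvw, hwg⟩

lemma IsMedian.card_out_le (hasymm : ∀ u v, r u v → ¬ r v u)
    (htot : ∀ u ∈ S, ∀ v ∈ S, u ≠ v → r u v ∨ r v u) {p : V → ℕ} (hp : IsMedian r S p)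
    {v : V} (hv : v ∈ S) (hlast : ∀ w ∈ S, p w ≤ p v) :
    #(out r S v) ≤ #(good r S p v) := by
  simpa using hp.card_out_le_card_good hasymm htot hv hlast 0

/-- Every nonempty tournament has a vertex with the second neighborhood property. -/
lemma exists_card_out_le_card_sec [Finite V] (hasymm : ∀ u v, r u v → ¬ r v u)
    (htot : ∀ u ∈ S, ∀ v ∈ S, u ≠ v → r u v ∨ r v u) (hS : S.Nonempty) :
    ∃ v ∈ S, #(out r S v) ≤ #(sec r S v) := by
  obtain ⟨p, hp⟩ := exists_isMedian (r := r) (S := S)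
  obtain ⟨v, hv, hlast⟩ := exists_max_image S p hS
  exact ⟨v, hv, (hp.card_out_le hasymm htot hv hlast).trans
    (card_le_card (good_subset_sec hasymm p v))⟩

/-- Sedimentation: if the last vertex `v` of a median order has as many out-neighbors as good
vertices, then these can be moved behind all other vertices. -/
lemma IsMedian.sedimentation [Finite V] (hasymm : ∀ u v, r u v → ¬ r v u)
    (htot : ∀ u ∈ S, ∀ v ∈ S, u ≠ v → r u v ∨ r v u) {p : V → ℕ} (hp : IsMedian r S p)
    {v : V} (hv : v ∈ S) (hlast : ∀ w ∈ S, p w ≤ p v)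
    (heq : #(out r S v) = #(good r S p v)) :
    ∃ q, IsMedian r S q ∧ ∀ c ∈ out r S v ∪ good r S p v,
      #{w ∈ S | p w < p c} < #{w ∈ S | q w < q c} := by
  have hirr : ∀ u, ¬ r u u := fun u h => hasymm u u h h
  have hlt : ∀ w ∈ S, w ≠ v → p w < p v := fun w hw hne =>
    lt_of_le_of_ne (hlast w hw) fun h => hne (hp.1 h)
  obtain ⟨N, hN⟩ : ∃ N, ∀ w, p w < N := by
    obtain ⟨N, hN⟩ := (Set.finite_range p).bddAbove
    exact ⟨N + 1, fun w => Nat.lt_succ_of_le (hN ⟨w, rfl⟩)⟩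
  set C := out r S v ∪ good r S p v with hC
  have hCS : C ⊆ S := union_subset (filter_subset _ _) (filter_subset _ _)
  have hvC : v ∉ C := by
    rw [hC, mem_union]
    rintro (h | h)
    · exact hirr v (mem_filter.1 h).2
    · exact hirr v (mem_filter.1 h).2.1
  set q : V → ℕ := fun w => if w ∈ C then p w + N else p w with hq
  have hqC : ∀ w ∈ C, q w = p w + N := fun w hw => by simp [hq, hw]
  have hqn : ∀ w, w ∉ C → q w = p w := fun w hw => by simp [hq, hw]
  have hqinj : q.Injective := by
    intro a b hab
    have ha' := hN a
    have hb' := hN b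
    by_cases ha : a ∈ C <;> by_cases hb : b ∈ C
    · rw [hqC a ha, hqC b hb] at hab
      exact hp.1 (by omega)
    · rw [hqC a ha, hqn b hb] at hab
      omega
    · rw [hqn a ha, hqC b hb] at hab
      omega
    · rw [hqn a ha, hqn b hb] at hab
      exact hp.1 hab
  -- a vertex outside `C` dominates at least half of the vertices of `C` preceding it
  have hhalf : ∀ b ∈ S \ C, #{c ∈ C | r c b ∧ p c < p b} ≤ #{c ∈ C | r b c ∧ p c < p b} := by
    intro b hb
    obtain ⟨hbS, hbC⟩ := mem_sdiff.1 hb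
    have hdom : ∀ w ∈ S, r v w → p w < p b → r b w := by
      intro w hw hvw hwb
      by_cases hbv : b = v
      · exact hbv ▸ hvw
      have hbv' : r b v := by
        rcases htot b hbS v hv hbv with h | h
        · exact h
        · exact absurd (mem_union_left _ (mem_filter.2 ⟨hbS, h⟩)) hbC
      rcases htot b hbS w hw (fun h => by subst h; omega) with h | h
      · exact h
      · exact absurd (mem_union_right _ (mem_filter.2 ⟨hbS, hbv', w, hw, hvw, hwb, h⟩)) hbC
    have hsplit : ∀ X : Finset V, b ∉ X →
        #X = #{c ∈ X | p c < p b} + #{c ∈ X | p b ≤ p c} := by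
      intro X hX
      rw [← card_filter_add_card_filter_not (s := X) (fun c => p c < p b)]
      simp only [not_lt]
    have ho := hsplit (out r S v) fun h => hbC (mem_union_left _ h)
    have hg := hsplit (good r S p v) fun h => hbC (mem_union_right _ h)
    -- Subtracting this suffix bound from `heq` reverses the inequality on the prefix: before `b`
    -- there are at most as many good vertices as out-neighbors of `v`.
    have hsuf := hp.card_out_le_card_good hasymm htot hv hlast (p b)
    calc _ ≤ #{c ∈ good r S p v | p c < p b} := by
          refine card_le_card ?_
          intro c hc
          obtain ⟨hcC, hcb, hlt'⟩ := mem_filter.1 hc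
          refine mem_filter.2 ⟨?_, hlt'⟩
          rcases mem_union.1 hcC with h | h
          · exact absurd (hdom c (hCS hcC) (mem_filter.1 h).2 hlt') (hasymm _ _ hcb)
          · exact h
      _ ≤ #{c ∈ out r S v | p c < p b} := by omega
      _ ≤ _ := by
          refine card_le_card ?_
          intro c hc
          obtain ⟨hc, hlt'⟩ := mem_filter.1 hc
          exact mem_filter.2 ⟨mem_union_left _ hc,
            hdom c (mem_filter.1 hc).1 (mem_filter.1 hc).2 hlt', hlt'⟩
  -- Arcs that stop being forward run from `C` to its complement, and the reversed kind is gained;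
  -- `hhalf` compares them head by head.
  have hback : fwd r S p \ fwd r S q ⊆
      (S \ C).biUnion fun b => {c ∈ C | r c b ∧ p c < p b}.image fun c => (c, b) := by
    rintro ⟨a, b⟩ hab
    simp only [fwd, mem_sdiff, mem_filter, mem_product] at hab
    obtain ⟨⟨⟨ha, hb⟩, hr, hlt'⟩, hn⟩ := hab
    have hn' : ¬ q a < q b := fun h => hn ⟨⟨ha, hb⟩, hr, h⟩
    have hNa := hN a
    have haC : a ∈ C := by
      by_contra haC
      rw [hqn a haC] at hn'
      by_cases hbC : b ∈ C
      · rw [hqC b hbC] at hn'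
        omega
      · rw [hqn b hbC] at hn'
        omega
    have hbC : b ∉ C := by
      intro hbC
      rw [hqC a haC, hqC b hbC] at hn'
      omega
    refine mem_biUnion.2 ⟨b, mem_sdiff.2 ⟨hb, hbC⟩, mem_image.2 ⟨a, ?_, rfl⟩⟩
    exact mem_filter.2 ⟨haC, hr, hlt'⟩
  have hforth : ((S \ C).biUnion fun b => {c ∈ C | r b c ∧ p c < p b}.image fun c => (b, c)) ⊆
      fwd r S q \ fwd r S p := by
    rintro ⟨b, c⟩ hbc
    obtain ⟨b', hb', hbc⟩ := mem_biUnion.1 hbc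
    obtain ⟨c', hc', hbc⟩ := mem_image.1 hbc
    obtain ⟨rfl, rfl⟩ := Prod.mk.inj hbc
    obtain ⟨hbS, hbC⟩ := mem_sdiff.1 hb'
    obtain ⟨hcC, hr, hlt'⟩ := mem_filter.1 hc'
    have := hN b'
    simp only [fwd, mem_sdiff, mem_filter, mem_product, hqC c' hcC, hqn b' hbC]
    exact ⟨⟨⟨hbS, hCS hcC⟩, hr, by omega⟩, fun h => by omega⟩
  have hcard : #(fwd r S p) ≤ #(fwd r S q) := by
    apply card_le_of_card_sdiff_le
    refine (card_le_card hback).trans (le_trans ?_ (card_le_card hforth))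
    refine card_biUnion_le.trans ?_
    rw [card_biUnion]
    · refine sum_le_sum fun b hb => card_image_le.trans ?_
      rw [card_image_of_injective _ (fun _ _ h => (Prod.mk.inj h).2)]
      exact hhalf b hb
    · intro b _ b' _ hne
      rw [Function.onFun, disjoint_left]
      intro e he he'
      obtain ⟨c, -, rfl⟩ := mem_image.1 he
      obtain ⟨c', -, h⟩ := mem_image.1 he'
      exact hne (Prod.mk.inj h).1.symm
  refine ⟨q, ⟨hqinj, fun q' hq' => (hp.2 q' hq').trans hcard⟩, fun c hc => ?_⟩
  -- No vertex preceding `c` is lost, and `v`, formerly last, now precedes it.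
  apply card_lt_card
  rw [Finset.ssubset_iff_of_subset]
  · refine ⟨v, mem_filter.2 ⟨hv, ?_⟩, fun h => ?_⟩
    · rw [hqC c hc, hqn v hvC]
      have := hN v
      omega
    · have := hlast c (hCS hc)
      have := (mem_filter.1 h).2
      omega
  · intro w hw
    obtain ⟨hwS, hlt'⟩ := mem_filter.1 hw
    refine mem_filter.2 ⟨hwS, ?_⟩
    have := hN w
    rw [hqC c hc]
    by_cases hwC : w ∈ C
    · rw [hqC w hwC]
      omega
    · rw [hqn w hwC]
      omega

/-- Havet–Thomassé: a nonempty tournament without sinks has two vertices with the second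
neighborhood property. -/
theorem exists_two_card_out_le_card_sec [Fintype V] [Nonempty V]
    (hasymm : ∀ u v, r u v → ¬ r v u) (htot : ∀ u v, u ≠ v → r u v ∨ r v u)
    (hsink : ∀ v, ∃ w, r v w) :
    ∃ u v, u ≠ v ∧ #(out r univ u) ≤ #(sec r univ u) ∧ #(out r univ v) ≤ #(sec r univ v) := by
  have hirr : ∀ u, ¬ r u u := fun u h => hasymm u u h h
  obtain ⟨s, -, hs⟩ := exists_card_out_le_card_sec (r := r) (S := univ) hasymm
    (fun u _ v _ => htot u v) univ_nonempty
  suffices h : ∃ v, v ≠ s ∧ #(out r univ v) ≤ #(sec r univ v) by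
    obtain ⟨v, hvs, hv⟩ := h
    exact ⟨s, v, hvs.symm, hs, hv⟩
  obtain ⟨x, hsx⟩ := hsink s
  set S : Finset V := univ.erase s with hS
  have hmem : ∀ w, w ∈ S ↔ w ≠ s := fun w => by simp [hS]
  have htotS : ∀ u ∈ S, ∀ v ∈ S, u ≠ v → r u v ∨ r v u := fun u _ v _ => htot u v
  have hxS : x ∈ S := (hmem x).2 fun h => hirr s (h ▸ hsx)
  -- The median order of `S` places `x` as late as possible, measured by predecessors because ranks
  -- are unbounded.
  obtain ⟨p, hp, hmax⟩ := exists_maximal (IsMedian r S) (fun p => #{w ∈ S | p w < p x}) #S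
    exists_isMedian (fun p => card_filter_le _ _)
  obtain ⟨v, hv, hlast⟩ := exists_max_image S p ⟨x, hxS⟩
  refine ⟨v, (hmem v).1 hv, ?_⟩
  have hog := hp.card_out_le hasymm htotS hv hlast
  have hgs := card_le_card (good_subset_sec (S := S) hasymm p v)
  have hsec : sec r S v ⊆ sec r univ v := by
    intro w hw
    obtain ⟨-, h1, h2, u, -, h3⟩ := mem_filter.1 hw
    exact mem_filter.2 ⟨mem_univ _, h1, h2, u, mem_univ _, h3⟩
  rcases htot v s ((hmem v).1 hv) with hvs | hsv
  · have hout : #(out r univ v) ≤ #(out r S v) + 1 := by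
      rw [← card_insert_of_notMem (a := s) (s := out r S v)
        (fun h => (hmem s).1 (mem_filter.1 h).1 rfl)]
      refine card_le_card ?_
      intro w hw
      by_cases hws : w = s
      · exact hws ▸ mem_insert_self _ _
      · exact mem_insert_of_mem (mem_filter.2 ⟨(hmem w).2 hws, (mem_filter.1 hw).2⟩)
    by_cases hlt : #(out r S v) < #(sec r S v)
    · have := card_le_card hsec
      omega
    -- Either sedimentation would push `x` later, against the choice of `p`, or the path `v → s → x`
    -- makes `x` a new second out-neighbor, compensating for the extra out-neighbor `s`.
    by_cases hx : x ∈ out r S v ∪ sec r S v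
    · exfalso
      have hge : good r S p v = sec r S v :=
        eq_of_subset_of_card_le (good_subset_sec hasymm p v) (by omega)
      obtain ⟨q, hq, hlt'⟩ := hp.sedimentation hasymm htotS hv hlast (by omega)
      have h1 := hlt' x (by rwa [hge])
      have h2 := hmax q hq
      omega
    · have hss : sec r S v ⊂ sec r univ v := by
        rw [Finset.ssubset_iff_of_subset hsec]
        refine ⟨x, mem_filter.2 ⟨mem_univ _, fun h => ?_, fun h => ?_, s, mem_univ _, hvs, hsx⟩,
          fun h => hx (mem_union_right _ h)⟩
        · exact hasymm _ _ hvs (h ▸ hsx)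
        · exact hx (mem_union_left _ (mem_filter.2 ⟨hxS, h⟩))
      have := card_lt_card hss
      omega
  · have hout : out r univ v ⊆ out r S v := by
      intro w hw
      have hvw := (mem_filter.1 hw).2
      exact mem_filter.2 ⟨(hmem w).2 fun h => hasymm _ _ hsv (h ▸ hvw), hvw⟩
    exact (card_le_card hout).trans ((hog.trans hgs).trans (card_le_card hsec))

end MedianOrder

/-! ### Digraphs missing two disjoint stars -/

namespace Digraph

open scoped Classical

variable {V : Type*}

/-- `D` has no loops and no digons, and its missing edges form two disjoint stars with centers
`x`, `y` and sets of leaves `A`, `B`. -/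
structure MissingStars (D : Digraph V) (x y : V) (A B : Set V) : Prop where
  asymm : ∀ u v, D.Adj u v → ¬ D.Adj v u
  center_ne : x ≠ y
  x_notMem_left : x ∉ A
  x_notMem_right : x ∉ B
  y_notMem_left : y ∉ A
  y_notMem_right : y ∉ B
  leaf_ne : ∀ a ∈ A, ∀ b ∈ B, a ≠ b
  left : ∀ a ∈ A, ¬ D.Adj x a ∧ ¬ D.Adj a x
  right : ∀ b ∈ B, ¬ D.Adj y b ∧ ¬ D.Adj b y
  adj : ∀ u v, u ≠ v → ¬ (u = x ∧ v ∈ A) → ¬ (v = x ∧ u ∈ A) → ¬ (u = y ∧ v ∈ B) →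
    ¬ (v = y ∧ u ∈ B) → D.Adj u v ∨ D.Adj v u

namespace MissingStars

variable {D : Digraph V} {x y : V} {A B : Set V}

lemma symm (h : D.MissingStars x y A B) : D.MissingStars y x B A where
  asymm := h.asymm
  center_ne := h.center_ne.symm
  x_notMem_left := h.y_notMem_right
  x_notMem_right := h.y_notMem_left
  y_notMem_left := h.x_notMem_right
  y_notMem_right := h.x_notMem_left
  leaf_ne b hb a ha := (h.leaf_ne a ha b hb).symm
  left := h.right
  right := h.left
  adj u v huv h1 h2 h3 h4 := h.adj u v huv h3 h4 h1 h2

lemma irrefl (h : D.MissingStars x y A B) (u : V) : ¬ D.Adj u u := fun hu => h.asymm u u hu hu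

lemma mem_missingEdges_left (h : D.MissingStars x y A B) {a : V} (ha : a ∈ A) :
    s(x, a) ∈ D.missingEdges :=
  ⟨x, a, rfl, fun e => h.x_notMem_left (e ▸ ha), h.left a ha⟩

lemma eq_of_mem_missingEdges (h : D.MissingStars x y A B) {e : Sym2 V}
    (he : e ∈ D.missingEdges) : (∃ a ∈ A, e = s(x, a)) ∨ ∃ b ∈ B, e = s(y, b) := by
  obtain ⟨u, v, rfl, huv, h1, h2⟩ := he
  by_contra hcon
  push Not at hcon
  rcases h.adj u v huv (fun ⟨hu, hv⟩ => hcon.1 v hv (by rw [hu]))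
    (fun ⟨hv, hu⟩ => hcon.1 u hu (by rw [hv, Sym2.eq_swap]))
    (fun ⟨hu, hv⟩ => hcon.2 v hv (by rw [hu]))
    (fun ⟨hv, hu⟩ => hcon.2 u hu (by rw [hv, Sym2.eq_swap])) with h | h
  · exact h1 h
  · exact h2 h

/-- This transfers domination: if `z` is adjacent to `w`, then `u → z` forces `w → z`. The condition
`hne` is needed because `outNbhd₂ u` never contains `u`. -/
lemma not_reach {u w : V} (hne : w ≠ u) (h : w ∉ D.outNbhd u ∪ D.outNbhd₂ u) :
    ¬ D.Adj u w ∧ ∀ z, D.Adj u z → ¬ D.Adj z w := by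
  have h1 : ¬ D.Adj u w := fun h' => h (Or.inl h')
  exact ⟨h1, fun z hz hzw => h (Or.inr ⟨hne, h1, z, hz, hzw⟩)⟩

/-- Inside one star, losing would require a loop at the center or an arc between the center and a
leaf. Between the stars, `x → y` leaves only one labelling. -/
lemma losesTo_left (h : D.MissingStars x y A B) (hxy : D.Adj x y) {a : V} (ha : a ∈ A)
    {f : Sym2 V} (hf : f ∈ D.missingEdges) (hl : D.LosesTo s(x, a) f) :
    ∃ b ∈ B, f = s(y, b) ∧ D.Adj a b ∧ (∀ z, D.Adj x z → ¬ D.Adj z b) ∧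
      ¬ D.Adj a y ∧ ∀ z, D.Adj a z → ¬ D.Adj z y := by
  obtain ⟨x₁, y₁, x₂, y₂, he, hf', h1, h2, h3, h4⟩ := hl
  have hay : a ≠ y := fun e => h.y_notMem_left (e ▸ ha)
  rcases h.eq_of_mem_missingEdges hf with ⟨a', ha', rfl⟩ | ⟨b, hb, rfl⟩
  · exfalso
    rcases Sym2.eq_iff.1 he with ⟨rfl, rfl⟩ | ⟨rfl, rfl⟩ <;>
    rcases Sym2.eq_iff.1 hf' with ⟨rfl, rfl⟩ | ⟨rfl, rfl⟩
    · exact h.irrefl _ h1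
    · exact (h.left _ ha').1 h1
    · exact (h.left _ ha).2 h1
    · exact h.irrefl _ h3
  · have hxb : b ≠ x := fun e => h.x_notMem_right (e ▸ hb)
    refine ⟨b, hb, rfl, ?_⟩
    rcases Sym2.eq_iff.1 he with ⟨rfl, rfl⟩ | ⟨rfl, rfl⟩ <;>
    rcases Sym2.eq_iff.1 hf' with ⟨rfl, rfl⟩ | ⟨rfl, rfl⟩
    · exact ⟨h3, (not_reach hxb h2).2, not_reach hay.symm h4⟩
    · exact absurd hxy (not_reach h.center_ne.symm h2).1
    · exact absurd hxy (not_reach h.center_ne.symm h4).1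
    · exact ⟨h1, (not_reach hxb h4).2, not_reach hay.symm h2⟩

lemma losesTo_right (h : D.MissingStars x y A B) (hxy : D.Adj x y) {b : V} (hb : b ∈ B)
    {f : Sym2 V} (hf : f ∈ D.missingEdges) (hl : D.LosesTo s(y, b) f) :
    ∃ a ∈ A, f = s(x, a) ∧ D.Adj y a ∧ D.Adj b x ∧ (∀ z, D.Adj y z → ¬ D.Adj z x) ∧
      ∀ z, D.Adj b z → ¬ D.Adj z a := by
  obtain ⟨x₁, y₁, x₂, y₂, he, hf', h1, h2, h3, h4⟩ := hl
  have hbx : b ≠ x := fun e => h.x_notMem_right (e ▸ hb)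
  have hyx := h.asymm _ _ hxy
  rcases h.eq_of_mem_missingEdges hf with ⟨a, ha, rfl⟩ | ⟨b', hb', rfl⟩
  · have hab : a ≠ b := h.leaf_ne a ha b hb
    refine ⟨a, ha, rfl, ?_⟩
    rcases Sym2.eq_iff.1 he with ⟨rfl, rfl⟩ | ⟨rfl, rfl⟩ <;>
    rcases Sym2.eq_iff.1 hf' with ⟨rfl, rfl⟩ | ⟨rfl, rfl⟩
    · exact absurd h1 hyx
    · exact ⟨h1, h3, (not_reach h.center_ne h2).2, (not_reach hab h4).2⟩
    · exact ⟨h3, h1, (not_reach h.center_ne h4).2, (not_reach hab h2).2⟩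
    · exact absurd h3 hyx
  · exfalso
    rcases Sym2.eq_iff.1 he with ⟨rfl, rfl⟩ | ⟨rfl, rfl⟩ <;>
    rcases Sym2.eq_iff.1 hf' with ⟨rfl, rfl⟩ | ⟨rfl, rfl⟩
    · exact h.irrefl _ h1
    · exact (h.right _ hb').1 h1
    · exact (h.right _ hb).2 h1
    · exact h.irrefl _ h3

end MissingStars

/-- The shape of a digraph missing two disjoint stars, with `x → y`, whose dependency digraph
has positive minimum degrees: the vertices of the stars form a module. -/
structure StarModule (D : Digraph V) (x y : V) (A B : Set V) : Prop extends
    D.MissingStars x y A B where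
  center : D.Adj x y
  nonempty : A.Nonempty
  right_left : ∀ a ∈ A, D.Adj y a
  leaf_center : ∀ b ∈ B, D.Adj b x
  module : ∀ k ∈ insert x A ∪ insert y B, ∀ z ∉ insert x A ∪ insert y B, D.Adj k z ↔ D.Adj x z

/-- For `z` outside the stars, domination of `z` passes round the cycle from `x` to `B`, to `A`, to
`y`, and back to `x`. In-degrees give the step from `x` to every `b`, out-degrees the step from
every `a` to `y`; both are used to match each leaf of `A` with one of `B` and conversely. -/
lemma MissingStars.starModule {D : Digraph V} {x y : V} {A B : Set V}
    (h : D.MissingStars x y A B) (hxy : D.Adj x y) (hne : D.missingEdges.Nonempty)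
    (hout : ∀ e ∈ D.missingEdges, ∃ f ∈ D.missingEdges, D.LosesTo e f)
    (hin : ∀ f ∈ D.missingEdges, ∃ e ∈ D.missingEdges, D.LosesTo e f) :
    D.StarModule x y A B := by
  have outA : ∀ a ∈ A, ∃ b ∈ B, D.Adj a b ∧ (∀ z, D.Adj x z → ¬ D.Adj z b) ∧
      ¬ D.Adj a y ∧ ∀ z, D.Adj a z → ¬ D.Adj z y := by
    intro a ha
    obtain ⟨f, hf, hl⟩ := hout _ (h.mem_missingEdges_left ha)
    obtain ⟨b, hb, -, h'⟩ := h.losesTo_left hxy ha hf hl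
    exact ⟨b, hb, h'⟩
  have outB : ∀ b ∈ B, ∃ a ∈ A, D.Adj y a ∧ D.Adj b x ∧ (∀ z, D.Adj y z → ¬ D.Adj z x) ∧
      ∀ z, D.Adj b z → ¬ D.Adj z a := by
    intro b hb
    obtain ⟨f, hf, hl⟩ := hout _ (h.symm.mem_missingEdges_left hb)
    obtain ⟨a, ha, -, h'⟩ := h.losesTo_right hxy hb hf hl
    exact ⟨a, ha, h'⟩
  have inA : ∀ a ∈ A, ∃ b ∈ B, D.Adj y a ∧ ∀ z, D.Adj b z → ¬ D.Adj z a := by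
    intro a ha
    obtain ⟨e, he, hl⟩ := hin _ (h.mem_missingEdges_left ha)
    rcases h.eq_of_mem_missingEdges he with ⟨a', ha', rfl⟩ | ⟨b, hb, rfl⟩
    · obtain ⟨b, hb, heq, -⟩ := h.losesTo_left hxy ha' (h.mem_missingEdges_left ha) hl
      rcases Sym2.eq_iff.1 heq with ⟨hc, -⟩ | ⟨hc, -⟩
      · exact absurd hc h.center_ne
      · exact absurd (hc ▸ hb) h.x_notMem_right
    · obtain ⟨a', ha', heq, h1, h2, h3, h4⟩ :=
        h.losesTo_right hxy hb (h.mem_missingEdges_left ha) hl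
      obtain rfl := Sym2.congr_right.1 heq
      exact ⟨b, hb, h1, h4⟩
  have inB : ∀ b ∈ B, ∃ a ∈ A, ∀ z, D.Adj x z → ¬ D.Adj z b := by
    intro b hb
    have hm := h.symm.mem_missingEdges_left hb
    obtain ⟨e, he, hl⟩ := hin _ hm
    rcases h.eq_of_mem_missingEdges he with ⟨a, ha, rfl⟩ | ⟨b', hb', rfl⟩
    · obtain ⟨b', hb', heq, h1, h2, -⟩ := h.losesTo_left hxy ha hm hl
      obtain rfl := Sym2.congr_right.1 heq
      exact ⟨a, ha, h2⟩
    · obtain ⟨a, ha, heq, -⟩ := h.losesTo_right hxy hb' hm hl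
      rcases Sym2.eq_iff.1 heq with ⟨hc, -⟩ | ⟨hc, -⟩
      · exact absurd hc.symm h.center_ne
      · exact absurd (hc ▸ ha) h.y_notMem_left
  have hA : A.Nonempty := by
    obtain ⟨e, he⟩ := hne
    rcases h.eq_of_mem_missingEdges he with ⟨a, ha, -⟩ | ⟨b, hb, -⟩
    · exact ⟨a, ha⟩
    · obtain ⟨a, ha, -⟩ := outB b hb
      exact ⟨a, ha⟩
  refine ⟨h, hxy, hA, fun a ha => (inA a ha).choose_spec.2.1, fun b hb => ?_, ?_⟩
  · obtain ⟨a, -, -, h', -⟩ := outB b hb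
    exact h'
  intro k hk z hz
  simp only [Set.mem_union, Set.mem_insert_iff, not_or] at hz
  have hadj : ∀ k ∈ insert x A ∪ insert y B, D.Adj k z ∨ D.Adj z k := by
    intro k hk
    simp only [Set.mem_union, Set.mem_insert_iff] at hk
    refine h.adj k z (fun e => ?_) (fun e => hz.1.2 e.2) (fun e => hz.1.1 e.1)
      (fun e => hz.2.2 e.2) (fun e => hz.2.1 e.1)
    subst e
    tauto
  have hxz : ∀ b ∈ B, D.Adj x z → D.Adj b z := by
    intro b hb hx
    obtain ⟨a, -, h'⟩ := inB b hb
    exact (hadj b (by simp [hb])).resolve_right (h' z hx)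
  have haz : ∀ a ∈ A, D.Adj a z → D.Adj y z := by
    intro a ha hz'
    obtain ⟨b, -, -, -, -, h'⟩ := outA a ha
    exact (hadj y (by simp)).resolve_right (h' z hz')
  have hyz : D.Adj y z → D.Adj x z := by
    intro hz'
    obtain ⟨a, ha⟩ := hA
    obtain ⟨b, hb, -⟩ := outA a ha
    obtain ⟨-, -, -, -, h', -⟩ := outB b hb
    exact (hadj x (by simp)).resolve_right (h' z hz')
  have hbz : ∀ a ∈ A, D.Adj x z → D.Adj a z := by
    intro a ha hx
    obtain ⟨b, hb, -, h'⟩ := inA a ha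
    exact (hadj a (by simp [ha])).resolve_right (h' z (hxz b hb hx))
  have hbz' : ∀ b ∈ B, D.Adj b z → D.Adj x z := by
    intro b hb hz'
    obtain ⟨a, ha, -, -, -, h'⟩ := outB b hb
    exact hyz (haz a ha ((hadj a (by simp [ha])).resolve_right (h' z hz')))
  rcases hk with (rfl | ha) | (rfl | hb)
  · rfl
  · exact ⟨fun h' => hyz (haz k ha h'), hbz k ha⟩
  · refine ⟨hyz, fun h' => ?_⟩
    obtain ⟨a, ha⟩ := hA
    exact haz a ha (hbz a ha h')
  · exact ⟨hbz' k hb, hxz k hb⟩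

/-! ### The second neighborhood property around a module -/

lemma hasSNP_iff [Fintype V] {D : Digraph V} {v : V} :
    D.HasSNP v ↔ #(MedianOrder.out D.Adj univ v) ≤ #(MedianOrder.sec D.Adj univ v) := by
  have h1 : D.outNbhd v = ↑(MedianOrder.out D.Adj univ v) := by
    ext w
    simp [outNbhd, MedianOrder.out]
  have h2 : D.outNbhd₂ v = ↑(MedianOrder.sec D.Adj univ v) := by
    ext w
    simp [outNbhd₂, MedianOrder.sec]
  rw [HasSNP, outDeg, outDeg₂, h1, h2, Set.ncard_coe_finset, Set.ncard_coe_finset]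

/-- If `P` and `Q` are the first and second out-neighborhoods outside a module and `|P| ≤ |Q|`,
then the second neighborhood property inside the module suffices. -/
lemma hasSNP_of_subset [Fintype V] {D : Digraph V} {v : V} {P Q O R : Finset V}
    (hPQ : #P ≤ #Q) (hOR : #O ≤ #R) (hd : Disjoint R Q)
    (hout : ∀ w, D.Adj v w → w ∈ O ∨ w ∈ P)
    (hR : ∀ w ∈ R, w ≠ v ∧ ¬ D.Adj v w ∧ ∃ u, D.Adj v u ∧ D.Adj u w)
    (hQ : ∀ w ∈ Q, w ≠ v ∧ ¬ D.Adj v w ∧ ∃ u, D.Adj v u ∧ D.Adj u w) : D.HasSNP v := by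
  rw [hasSNP_iff]
  have h1 : #(MedianOrder.out D.Adj univ v) ≤ #O + #P := by
    refine (card_le_card fun w hw => ?_).trans (card_union_le O P)
    exact mem_union.2 (hout w (mem_filter.1 hw).2)
  have h2 : #R + #Q ≤ #(MedianOrder.sec D.Adj univ v) := by
    rw [← card_union_of_disjoint hd]
    refine card_le_card fun w hw => ?_
    have : w ≠ v ∧ ¬ D.Adj v w ∧ ∃ u, D.Adj v u ∧ D.Adj u w :=
      (mem_union.1 hw).elim (hR w) (hQ w)
    simpa [MedianOrder.sec] using this
  omega

lemma StarModule.exists_two_hasSNP [Fintype V] {D : Digraph V} {x y : V} {A B : Set V}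
    (h : D.StarModule x y A B) (hsink : ∀ v, ∃ w, D.Adj v w) :
    ∃ u v, u ≠ v ∧ D.HasSNP u ∧ D.HasSNP v := by
  set K : Set V := insert x A ∪ insert y B with hK
  have hxK : x ∈ K := by simp [hK]
  have hyK : y ∈ K := by simp [hK]
  have hAK : ∀ a ∈ A, a ∈ K := fun a ha => by simp [hK, ha]
  have hBK : ∀ b ∈ B, b ∈ K := fun b hb => by simp [hK, hb]
  have hmod := h.module
  have hadj : ∀ k ∈ K, ∀ z ∉ K, D.Adj k z ∨ D.Adj z k := by
    intro k hk z hz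
    refine h.adj k z (fun e => hz (e ▸ hk)) (fun e => hz (hAK z e.2)) (fun e => hz (e.1 ▸ hxK))
      (fun e => hz (hBK z e.2)) (fun e => hz (e.1 ▸ hyK))
  set P : Finset V := {z | z ∉ K ∧ D.Adj x z} with hP
  -- Paths through `K` can be ignored here: an out-neighbor outside `K` of a vertex of `K` already
  -- lies in `P`.
  set Q : Finset V := {z | z ∉ K ∧ ¬ D.Adj x z ∧ ∃ w, w ∉ K ∧ D.Adj x w ∧ D.Adj w z} with hQ
  by_cases hPQ : #P ≤ #Q
  · have hQ' : ∀ k ∈ K, ∀ w ∈ Q, w ≠ k ∧ ¬ D.Adj k w ∧ ∃ u, D.Adj k u ∧ D.Adj u w := by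
      intro k hk w hw
      obtain ⟨-, hwK, hxw, z, hzK, hxz, hzw⟩ := mem_filter.1 hw
      exact ⟨fun e => hwK (e ▸ hk), fun e => hxw ((hmod k hk w hwK).1 e), z,
        (hmod k hk z hzK).2 hxz, hzw⟩
    have hP' : ∀ k ∈ K, ∀ w, w ∉ K → D.Adj k w → w ∈ P := by
      intro k hk w hw hkw
      exact mem_filter.2 ⟨mem_univ _, hw, (hmod k hk w hw).1 hkw⟩
    have hdisj : ∀ R : Finset V, (∀ w ∈ R, w ∈ K) → Disjoint R Q := by
      intro R hR
      rw [disjoint_left]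
      intro w hw hw'
      exact (mem_filter.1 hw').2.1 (hR w hw)
    have hx : D.HasSNP x := by
      obtain ⟨a, ha⟩ := h.nonempty
      -- Inside `K`, the only out-neighbor of `x` is `y`, and `x → y → a` reaches a leaf.
      refine hasSNP_of_subset (O := {y}) (R := {a}) hPQ (by simp) (hdisj _ ?_) ?_ ?_
        (hQ' x hxK)
      · intro w hw
        rw [mem_singleton.1 hw]
        exact hAK a ha
      · intro w hw
        by_cases hwK : w ∈ K
        · left
          rcases hwK with (rfl | hwA) | (rfl | hwB)
          · exact absurd hw (h.irrefl _)
          · exact absurd hw (h.left w hwA).1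
          · simp
          · exact absurd hw (h.asymm _ _ (h.leaf_center w hwB))
        · exact Or.inr (hP' x hxK w hwK hw)
      · intro w hw
        rw [mem_singleton.1 hw]
        exact ⟨fun e => h.x_notMem_left (e ▸ ha), (h.left a ha).1, y, h.center,
          h.right_left a ha⟩
    set S : Finset V := {w | w ∈ A ∪ B} with hS
    have hmem : ∀ w, w ∈ S ↔ w ∈ A ∨ w ∈ B := fun w => by simp [hS]
    have hxS : x ∉ S := fun e => ((hmem x).1 e).elim h.x_notMem_left h.x_notMem_right
    have hyS : y ∉ S := fun e => ((hmem y).1 e).elim h.y_notMem_left h.y_notMem_right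
    have hSK : ∀ w ∈ S, w ∈ K := fun w hw => ((hmem w).1 hw).elim (hAK w) (hBK w)
    -- Missing edges always involve a center, so the leaves induce a tournament.
    obtain ⟨v, hv, hle⟩ := MedianOrder.exists_card_out_le_card_sec (r := D.Adj) (S := S)
      h.asymm (fun u hu v hv huv => h.adj u v huv (fun e => hxS (e.1 ▸ hu))
        (fun e => hxS (e.1 ▸ hv)) (fun e => hyS (e.1 ▸ hu)) (fun e => hyS (e.1 ▸ hv)))
      (by
        obtain ⟨a, ha⟩ := h.nonempty
        exact ⟨a, (hmem a).2 (Or.inl ha)⟩)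
    have hvK := hSK v hv
    have hsec : ∀ w ∈ MedianOrder.sec D.Adj S v,
        w ≠ v ∧ ¬ D.Adj v w ∧ ∃ u, D.Adj v u ∧ D.Adj u w := by
      intro w hw
      obtain ⟨-, h1, h2, u, -, h3⟩ := mem_filter.1 hw
      exact ⟨h1, h2, u, h3⟩
    have hsecK : ∀ w ∈ MedianOrder.sec D.Adj S v, w ∈ K := fun w hw =>
      hSK w (mem_filter.1 hw).1
    refine ⟨x, v, fun e => hxS (e ▸ hv), hx, ?_⟩
    rcases (hmem v).1 hv with hvA | hvB
    · refine hasSNP_of_subset hPQ hle (hdisj _ hsecK) ?_ hsec (hQ' v hvK)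
      intro w hw
      by_cases hwK : w ∈ K
      · left
        rcases hwK with (rfl | hwA) | (rfl | hwB)
        · exact absurd hw (h.left v hvA).2
        · exact mem_filter.2 ⟨(hmem w).2 (Or.inl hwA), hw⟩
        · exact absurd hw (h.asymm _ _ (h.right_left v hvA))
        · exact mem_filter.2 ⟨(hmem w).2 (Or.inr hwB), hw⟩
      · exact Or.inr (hP' v hvK w hwK hw)
    -- A leaf of `B` gains the out-neighbor `x`, but also the second out-neighbor `y` through `x →
    -- y`.
    · refine hasSNP_of_subset (O := insert x (MedianOrder.out D.Adj S v))
        (R := insert y (MedianOrder.sec D.Adj S v)) hPQ ?_ (hdisj _ ?_) ?_ ?_ (hQ' v hvK)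
      · have hx' : x ∉ MedianOrder.out D.Adj S v := fun e => hxS (mem_filter.1 e).1
        have hy' : y ∉ MedianOrder.sec D.Adj S v := fun e => hyS (mem_filter.1 e).1
        rw [card_insert_of_notMem hx', card_insert_of_notMem hy']
        omega
      · intro w hw
        rcases mem_insert.1 hw with rfl | hw
        · exact hyK
        · exact hsecK w hw
      · intro w hw
        by_cases hwK : w ∈ K
        · left
          rcases hwK with (rfl | hwA) | (rfl | hwB)
          · exact mem_insert_self _ _
          · exact mem_insert_of_mem (mem_filter.2 ⟨(hmem w).2 (Or.inl hwA), hw⟩)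
          · exact absurd hw (h.right v hvB).2
          · exact mem_insert_of_mem (mem_filter.2 ⟨(hmem w).2 (Or.inr hwB), hw⟩)
        · exact Or.inr (hP' v hvK w hwK hw)
      · intro w hw
        rcases mem_insert.1 hw with rfl | hw
        · exact ⟨fun e => hyS (e ▸ hv), (h.right v hvB).2, x, h.leaf_center v hvB, h.center⟩
        · exact hsec w hw
  -- replace the module by a transitive tournament
  obtain ⟨n, ⟨e⟩⟩ := Finite.exists_equiv_fin V
  obtain ⟨r, hr⟩ : ∃ r : V → V → Prop,
      r = fun u v => if u ∈ K ∧ v ∈ K then e u < e v else D.Adj u v := ⟨_, rfl⟩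
  have hrK : ∀ u ∈ K, ∀ v ∈ K, (r u v ↔ e u < e v) := fun u hu v hv => by simp [hr, hu, hv]
  have hrl : ∀ u v, u ∉ K → (r u v ↔ D.Adj u v) := fun u v hu => by simp [hr, hu]
  have hrr : ∀ u v, v ∉ K → (r u v ↔ D.Adj u v) := fun u v hv => by simp [hr, hv]
  have hasymm : ∀ u v, r u v → ¬ r v u := by
    intro u v
    by_cases hu : u ∈ K
    · by_cases hv : v ∈ K
      · rw [hrK u hu v hv, hrK v hv u hu]
        exact fun h => h.asymm
      · rw [hrr u v hv, hrl v u hv]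
        exact h.asymm u v
    · rw [hrl u v hu, hrr v u hu]
      exact h.asymm u v
  have htot : ∀ u v, u ≠ v → r u v ∨ r v u := by
    intro u v huv
    by_cases hu : u ∈ K
    · by_cases hv : v ∈ K
      · rw [hrK u hu v hv, hrK v hv u hu]
        exact lt_or_gt_of_ne fun h => huv (e.injective h)
      · rw [hrr u v hv, hrl v u hv]
        exact hadj u hu v hv
    · rw [hrl u v hu, hrr v u hu]
      exact h.adj u v huv (fun e => hu (e.1 ▸ hxK)) (fun e => hu (hAK u e.2))
        (fun e => hu (e.1 ▸ hyK)) (fun e => hu (hBK u e.2))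
  have hrsink : ∀ u, ∃ w, r u w := by
    intro u
    by_cases hu : u ∈ K
    · obtain ⟨z, hz⟩ : P.Nonempty := card_pos.1 (by omega)
      obtain ⟨-, hzK, hxz⟩ := mem_filter.1 hz
      exact ⟨z, (hrr u z hzK).2 ((hmod u hu z hzK).2 hxz)⟩
    · obtain ⟨w, hw⟩ := hsink u
      exact ⟨w, (hrl u w hu).2 hw⟩
  have : Nonempty V := ⟨x⟩
  obtain ⟨u, v, huv, hu, hv⟩ :=
    MedianOrder.exists_two_card_out_le_card_sec (r := r) hasymm htot hrsink
  -- A vertex of `K` keeps all of `P` as out-neighbors, while its second out-neighbors lie in `Q`: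
  -- transitivity excludes those reached within `K`, and a path leaving `K` cannot return to it.
  have hnot : ∀ k, #(MedianOrder.out r univ k) ≤ #(MedianOrder.sec r univ k) → k ∉ K := by
    intro k hle hk
    refine hPQ (le_trans (card_le_card fun z hz => ?_) (hle.trans (card_le_card fun w hw => ?_)))
    · obtain ⟨-, hzK, hxz⟩ := mem_filter.1 hz
      exact mem_filter.2 ⟨mem_univ _, (hrr k z hzK).2 ((hmod k hk z hzK).2 hxz)⟩
    · obtain ⟨-, hwk, hkw, z, -, hkz, hzw⟩ := mem_filter.1 hw
      by_cases hwK : w ∈ K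
      · exfalso
        by_cases hzK : z ∈ K
        · rw [hrK _ hk _ hzK] at hkz
          rw [hrK _ hzK _ hwK] at hzw
          rw [hrK _ hk _ hwK] at hkw
          exact hkw (hkz.trans hzw)
        · rw [hrr _ _ hzK, hmod k hk z hzK] at hkz
          rw [hrl _ _ hzK] at hzw
          exact h.asymm _ _ hzw ((hmod w hwK z hzK).2 hkz)
      · rw [hrr _ _ hwK] at hkw hzw
        rw [hmod k hk w hwK] at hkw
        by_cases hzK : z ∈ K
        · exact absurd ((hmod z hzK w hwK).1 hzw) hkw
        · rw [hrr _ _ hzK, hmod k hk z hzK] at hkz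
          exact mem_filter.2 ⟨mem_univ _, hwK, hkw, z, hzK, hkz, hzw⟩
  have hsnp : ∀ k, #(MedianOrder.out r univ k) ≤ #(MedianOrder.sec r univ k) → D.HasSNP k := by
    intro k hle
    have hk := hnot k hle
    rw [hasSNP_iff]
    refine le_trans (card_le_card fun z hz => ?_) (hle.trans (card_le_card fun w hw => ?_))
    · exact mem_filter.2 ⟨mem_univ _, (hrl k z hk).2 (mem_filter.1 hz).2⟩
    · obtain ⟨-, hwk, hkw, z, -, hkz, hzw⟩ := mem_filter.1 hw
      rw [hrl _ _ hk] at hkw hkz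
      refine mem_filter.2 ⟨mem_univ _, hwk, hkw, z, mem_univ _, hkz, ?_⟩
      -- An arc altered inside `K` cannot give a second out-neighbor of an outside vertex `k`: if `k
      -- → z`, then `k` dominates all of `K`, including `w`.
      by_cases hzw' : z ∈ K ∧ w ∈ K
      · exfalso
        obtain ⟨hzK, hwK⟩ := hzw'
        rcases hadj w hwK k hk with h' | h'
        · exact h.asymm _ _ hkz ((hmod z hzK k hk).2 ((hmod w hwK k hk).1 h'))
        · exact hkw h'
      · simpa [hr, hzw'] using hzw
  exact ⟨u, v, huv, hsnp u hu, hsnp v hv⟩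

/-! ### From deleted stars and minimum degrees to the structural hypotheses -/

lemma MissingStars.of_deleteEdges {T : Digraph V} (hT : T.IsTournament) {x y : V} {A B : Set V}
    (hx : x ∉ A) (hy : y ∉ B) (hdisj : Disjoint (insert x A) (insert y B)) :
    (T.deleteEdges (starEdges x A ∪ starEdges y B)).MissingStars x y A B := by
  have hne : ∀ u ∈ insert x A, ∀ v ∈ insert y B, u ≠ v := fun u hu v hv e =>
    Set.disjoint_left.1 hdisj hu (e ▸ hv)
  have hA : ∀ a ∈ A, s(x, a) ∈ starEdges x A ∪ starEdges y B := fun a ha =>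
    Or.inl ⟨a, ha, rfl⟩
  have hB : ∀ b ∈ B, s(y, b) ∈ starEdges x A ∪ starEdges y B := fun b hb =>
    Or.inr ⟨b, hb, rfl⟩
  refine ⟨?_, hne x (by simp) y (by simp), hx, fun e => hne x (by simp) x (by simp [e]) rfl,
    fun e => hne y (by simp [e]) y (by simp) rfl, hy,
    fun a ha b hb => hne a (by simp [ha]) b (by simp [hb]), ?_, ?_, ?_⟩
  · intro u v huv hvu
    have huv' : u ≠ v := fun e => hT.1 v (e ▸ huv.1)
    rcases hT.2 u v huv' with h | h
    · exact h.2 hvu.1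
    · exact h.2 huv.1
  · intro a ha
    exact ⟨fun h => h.2 (hA a ha), fun h => h.2 (Sym2.eq_swap ▸ hA a ha)⟩
  · intro b hb
    exact ⟨fun h => h.2 (hB b hb), fun h => h.2 (Sym2.eq_swap ▸ hB b hb)⟩
  · intro u v huv h1 h2 h3 h4
    have hE : s(u, v) ∉ starEdges x A ∪ starEdges y B := by
      rintro (⟨a, ha, he⟩ | ⟨b, hb, he⟩)
      · rcases Sym2.eq_iff.1 he with ⟨rfl, rfl⟩ | ⟨rfl, rfl⟩
        · exact h1 ⟨rfl, ha⟩
        · exact h2 ⟨rfl, ha⟩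
      · rcases Sym2.eq_iff.1 he with ⟨rfl, rfl⟩ | ⟨rfl, rfl⟩
        · exact h3 ⟨rfl, hb⟩
        · exact h4 ⟨rfl, hb⟩
    rcases hT.2 u v huv with h | h
    · exact Or.inl ⟨h.1, hE⟩
    · exact Or.inr ⟨h.1, Sym2.eq_swap ▸ hE⟩

lemma exists_adj_of_minOutDeg_pos [Finite V] {D : Digraph V} (h : 0 < D.minOutDeg) (v : V) :
    ∃ w, D.Adj v w := by
  have h1 : 0 < D.outDeg v := h.trans_le (ciInf_le (OrderBot.bddBelow _) v)
  exact (Set.ncard_pos (Set.toFinite _)).1 h1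

lemma exists_adj_of_minInDeg_pos [Finite V] {D : Digraph V} (h : 0 < D.minInDeg) (v : V) :
    ∃ w, D.Adj w v := by
  have h1 : 0 < D.inDeg v := h.trans_le (ciInf_le (OrderBot.bddBelow _) v)
  exact (Set.ncard_pos (Set.toFinite _)).1 h1

/-- An infimum over the empty type is `0` in `ℕ`, so a positive minimum out-degree already provides
a missing edge. -/
lemma nonempty_of_minOutDeg_pos {D : Digraph V} (h : 0 < D.minOutDeg) : Nonempty V := by
  by_contra hV
  rw [not_nonempty_iff] at hV
  rw [minOutDeg, Nat.iInf_of_empty] at h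
  exact lt_irrefl _ h

end Digraph

theorem theorem7 {V : Type*} [Finite V] (T D : Digraph V) (hT : T.IsTournament)
    (x y : V) (A B : Set V) (hx : x ∉ A) (hy : y ∉ B)
    (hdisj : Disjoint (insert x A) (insert y B))
    (hD : D = T.deleteEdges (Digraph.starEdges x A ∪ Digraph.starEdges y B))
    (hout : 0 < D.dependency.minOutDeg) (hin : 0 < D.dependency.minInDeg)
    (hsink : ∀ v, ¬ D.IsSink v) :
    ∃ u v : V, u ≠ v ∧ D.HasSNP u ∧ D.HasSNP v := by
  have := Fintype.ofFinite V
  have h : D.MissingStars x y A B := hD ▸ .of_deleteEdges hT hx hy hdisj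
  have hne : D.missingEdges.Nonempty := by
    obtain ⟨e, he⟩ := Digraph.nonempty_of_minOutDeg_pos hout
    exact ⟨e, he⟩
  have hout' : ∀ e ∈ D.missingEdges, ∃ f ∈ D.missingEdges, D.LosesTo e f := by
    intro e he
    obtain ⟨⟨f, hf⟩, hl⟩ := Digraph.exists_adj_of_minOutDeg_pos hout ⟨e, he⟩
    exact ⟨f, hf, hl⟩
  have hin' : ∀ f ∈ D.missingEdges, ∃ e ∈ D.missingEdges, D.LosesTo e f := by
    intro f hf
    obtain ⟨⟨e, he⟩, hl⟩ := Digraph.exists_adj_of_minInDeg_pos hin ⟨f, hf⟩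
    exact ⟨e, he, hl⟩
  have hsink' : ∀ v, ∃ w, D.Adj v w := fun v =>
    (Set.ncard_pos (Set.toFinite _)).1 (Nat.pos_of_ne_zero (hsink v))
  -- Exchanging the two stars covers the orientation `y → x`.
  rcases h.adj x y h.center_ne (fun e => h.y_notMem_left e.2) (fun e => h.center_ne e.1.symm)
    (fun e => h.center_ne e.1) (fun e => h.x_notMem_right e.2) with hxy | hyx
  · exact (h.starModule hxy hne hout' hin').exists_two_hasSNP hsink'
  · exact (h.symm.starModule hyx hne hout' hin').exists_two_hasSNP hsink'
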